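/- Let $r$ be a prime. An $r$-uniform hypergraph with multiplicities $\mathcal S$ on a finite node set $V$ is given by a set $E(\mathcal S)$ of hyperedges, each of which is a multiset of $r$ elements of $V$ containing at least two different nodes; $\mathcal S$ is without multiplicities if every hyperedge consists of $r$ distinct nodes. A colouring with $m$ colours is a map $c:V\to[m]$ that is not constant on any hyperedge, and $\chi(\mathcal S)$ is the smallest $m$ for which one exists. The box complex $B(\mathcal S)$ is the simplicial complex on the disjoint union of $r$ copies of $V$ whose simplices are the $r$-tuples $(U_1,\dots,U_r)$ of subsets of $V$, not all empty, such that if all $U_i$ are nonempty, then $\{\!\{u_1,\dots,u_r\}\!\}\in E(\mathcal S)$ for all $u_1\in U_1,\dots,u_r\in U_r$. The colour complex $\mathcal C$ is the simplicial complex on $r$ copies of $[\chi(\mathcal S)]$ whose simplices are the $r$-tuples $(C_1,\dots,C_r)$ of subsets of $[\chi(\mathcal S)]$, not all empty, with $\bigcap_i C_i=\emptyset$. The group $\mathbb Z_r$ acts on both by cyclically shifting the copies. For $n\ge -1$, an $E_n\mathbb Z_r$-space is a free $\mathbb Z_r$-space that is triangulated by a finite simplicial complex of dimension $n$ and is $(n-1)$-connected,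 where $\dim\emptyset=-1$ and a space is $k$-connected if every continuous map from $S^l$ to it extends to the ball $B^{l+1}$, for $-1\le l\le k$ (with $S^{-1}=\emptyset$). The index $\mathrm{ind}_{\mathbb Z_r}(X)$ of a free $\mathbb Z_r$-space $X$ is the smallest $n$ such that there is a continuous $\mathbb Z_r$-equivariant map from $X$ to some $E_n\mathbb Z_r$-space. Theorem. Let $r$ be a prime and let $\mathcal S$ be an $r$-uniform hypergraph, with or without multiplicities, on a finite node set $V$. Then $\chi(\mathcal S)$ is well defined (some colouring with finitely many colours exists), the realization $\|B(\mathcal S)\|$ is a free $\mathbb Z_r$-space, its index $\mathrm{ind}_{\mathbb Z_r}(B(\mathcal S))$ is well defined (the minimum is attained), and $$\chi(\mathcal S)\ \ge\ \left\lceil\frac{\mathrm{ind}_{\mathbb Z_r}(B(\mathcal S))+1}{r-1}\right\rceil .$$ Moreover, for each colouring $c:V\to[\chi(\mathcal S)]$ of $\mathcal S$, the map that sends a node $v$ in the $i$-th copy of $V$ to the colour $c(v)$ in the $i$-th copy of $[\chi(\mathcal S)]$ is a $\mathbb Z_r$-equivariant simplicial map $f_c:B(\mathcal S)\to\mathcal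 C$, and $\dim(\operatorname{im} f_c)\le(r-1)\cdot\chi(\mathcal S)-1$. -/

import Mathlib

/-! Uniform hypergraphs with or without multiplicities, their box complexes, colour complexes,
and the index of a space with an action of the cyclic group of order `r`. -/

namespace BoxIndex

/-! ### Uniform hypergraphs and their colourings -/

/-- An `r`-uniform hypergraph on the node set `V`, with multiplicities allowed: a hyperedge is a
multiset of `r` nodes that contains at least two different nodes. -/
structure UniformHypergraph (r : ℕ) (V : Type*) where
  edges : Set (Multiset V)
  card_eq : ∀ e ∈ edges, Multiset.card e = r
  exists_ne : ∀ e ∈ edges, ∃ x ∈ e, ∃ y ∈ e, x ≠ y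

namespace UniformHypergraph

variable {r : ℕ} {V : Type*}

/-- The hypergraph has no multiplicities: each hyperedge consists of `r` distinct nodes. -/
def MultiplicityFree (S : UniformHypergraph r V) : Prop :=
  ∀ e ∈ S.edges, e.Nodup

/-- No hyperedge is monochromatic. -/
def IsColouring (S : UniformHypergraph r V) {m : ℕ} (c : V → Fin m) : Prop :=
  ∀ e ∈ S.edges, ∃ x ∈ e, ∃ y ∈ e, c x ≠ c y

def Colourable (S : UniformHypergraph r V) (m : ℕ) : Prop :=
  ∃ c : V → Fin m, S.IsColouring c

/-- The smallest number of colours of a colouring. -/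
noncomputable def chromaticNumber (S : UniformHypergraph r V) : ℕ :=
  sInf {m : ℕ | S.Colourable m}

/-- A family of `r`-element subsets of `V`, `r ≥ 2`, as a hypergraph without multiplicities. -/
def ofSets (hr : 2 ≤ r) (E : Set (Finset V)) (hE : ∀ e ∈ E, e.card = r) :
    UniformHypergraph r V where
  edges := Finset.val '' E
  card_eq := by
    rintro _ ⟨e, he, rfl⟩
    exact hE e he
  exists_ne := by
    rintro _ ⟨e, he, rfl⟩
    have h : 1 < e.card := by rw [hE e he]; omega
    obtain ⟨x, hx, y, hy, hxy⟩ := Finset.one_lt_card.1 h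
    exact ⟨x, hx, y, hy, hxy⟩

theorem ofSets_multiplicityFree (hr : 2 ≤ r) (E : Set (Finset V)) (hE : ∀ e ∈ E, e.card = r) :
    (ofSets hr E hE).MultiplicityFree := by
  rintro _ ⟨e, _, rfl⟩
  exact e.nodup

end UniformHypergraph

/-! ### Simplicial complexes -/

section Complexes

variable {ι κ : Type*}

/-- The dimension of a finite simplicial complex (`-1` if it has no simplices). -/
noncomputable def dim [Fintype ι] (K : PreAbstractSimplicialComplex ι) : ℤ :=
  open Classical in ((Finset.univ.filter (· ∈ K.faces)).sup Finset.card : ℕ) - 1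

/-- The geometric realization of a finite simplicial complex: all convex combinations
(barycentric coordinates) of the vertices that are supported on a simplex. -/
def realization [Fintype ι] (K : PreAbstractSimplicialComplex ι) : Set (ι → ℝ) :=
  {x | x ∈ stdSimplex ℝ ι ∧ ∃ σ ∈ K.faces, ∀ p, p ∉ σ → x p = 0}

/-- The vertex map `f` maps simplices to simplices. -/
def IsSimplicialMap [DecidableEq κ] (K : PreAbstractSimplicialComplex ι)
    (L : PreAbstractSimplicialComplex κ) (f : ι → κ) : Prop :=
  ∀ σ ∈ K.faces, σ.image f ∈ L.faces

/-- `K` is invariant under an action of `G` on the vertices, so that `G` acts simplicially. -/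
class IsInvariant (G : Type*) [AddGroup G] [AddAction G ι]
    (K : PreAbstractSimplicialComplex ι) : Prop where
  map_mem : ∀ (g : G), ∀ σ ∈ K.faces, σ.map (AddAction.toPerm g).toEmbedding ∈ K.faces

/-- The action on the realization induced by a simplicial action; `g` moves the point with
barycentric coordinate 1 at the vertex `p` to the one with coordinate 1 at `g +ᵥ p`. -/
instance realizationAction (G : Type*) [AddGroup G] [AddAction G ι] [Fintype ι]
    (K : PreAbstractSimplicialComplex ι) [IsInvariant G K] :
    AddAction G (realization K) where
  vadd g x := ⟨fun p => x.1 (-g +ᵥ p), by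
    obtain ⟨x, ⟨h0, h1⟩, σ, hσ, hx⟩ := x
    refine ⟨⟨fun p => h0 _, ?_⟩, _, IsInvariant.map_mem g σ hσ, fun p hp => hx _ fun h => hp ?_⟩
    · exact (Equiv.sum_comp (AddAction.toPerm (-g)) x).trans h1
    · exact Finset.mem_map.2 ⟨_, h, by simp⟩⟩
  zero_vadd x := by
    apply Subtype.ext
    funext p
    change x.1 (-(0 : G) +ᵥ p) = x.1 p
    simp
  add_vadd g h x := by
    apply Subtype.ext
    funext p
    change x.1 (-(g + h) +ᵥ p) = x.1 (-h +ᵥ (-g +ᵥ p))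
    rw [neg_add_rev, add_vadd]

end Complexes

/-! ### Spaces with an action of the cyclic group, and their index -/

/-- `X` with the given action of `ℤ/r` is a free `ℤ/r`-space. -/
structure IsFreeSpace (r : ℕ) (X : Type*) [TopologicalSpace X] [AddAction (ZMod r) X] :
    Prop where
  continuous_vadd : ∀ g : ZMod r, Continuous fun x : X => g +ᵥ x
  free : ∀ g : ZMod r, g ≠ 0 → ∀ x : X, g +ᵥ x ≠ x

/-- `Y` is `k`-connected: for `-1 ≤ l ≤ k` each continuous map from the sphere `S^l` extends to the
ball `B^(l+1)`. Here `j = l + 1`; the sphere `S^(-1)` is empty and the ball `B^0` is a point, so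
that `(-1)`-connected means nonempty. -/
def IsKConnected (k : ℤ) (Y : Type*) [TopologicalSpace Y] : Prop :=
  ∀ j : ℕ, (j : ℤ) - 1 ≤ k →
    ∀ f : C(Metric.sphere (0 : EuclideanSpace ℝ (Fin j)) 1, Y),
      ∃ F : C(Metric.closedBall (0 : EuclideanSpace ℝ (Fin j)) 1, Y),
        ∀ x, F ⟨x.1, Metric.sphere_subset_closedBall x.2⟩ = f x

/-- `Y` is an `E_n`-space for `ℤ/r`: a free `ℤ/r`-space, triangulated by a finite simplicial complex
of dimension `n`, that is `(n-1)`-connected. -/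
structure IsESpace (r : ℕ) (n : ℤ) (Y : Type) [TopologicalSpace Y] [AddAction (ZMod r) Y] :
    Prop where
  isFreeSpace : IsFreeSpace r Y
  triangulated : ∃ (ι : Type) (_ : Fintype ι) (K : PreAbstractSimplicialComplex ι),
    dim K = n ∧ Nonempty (Y ≃ₜ realization K)
  connected : IsKConnected (n - 1) Y

/-- All `n` for which there is a continuous equivariant map from `X` to some `E_n`-space. -/
def indexSet (r : ℕ) (X : Type*) [TopologicalSpace X] [AddAction (ZMod r) X] : Set ℤ :=
  {n | ∃ (Y : Type) (_ : TopologicalSpace Y) (_ : AddAction (ZMod r) Y), IsESpace r n Y ∧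
    ∃ f : C(X, Y), ∀ (g : ZMod r) (x : X), f (g +ᵥ x) = g +ᵥ f x}

/-- The `ℤ/r`-index: the smallest element of `indexSet`. -/
noncomputable def zIndex (r : ℕ) (X : Type*) [TopologicalSpace X] [AddAction (ZMod r) X] : ℤ :=
  sInf (indexSet r X)

/-! ### Box complexes and colour complexes -/

/-- The disjoint union of `r` copies of `A`, indexed by `ℤ/r`. -/
def Copies (r : ℕ) (A : Type*) : Type _ := ZMod r × A

namespace Copies

variable {r : ℕ} {A : Type*}

instance [NeZero r] [Fintype A] : Fintype (Copies r A) :=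
  inferInstanceAs (Fintype (ZMod r × A))

instance [DecidableEq A] : DecidableEq (Copies r A) :=
  inferInstanceAs (DecidableEq (ZMod r × A))

/-- The cyclic shift of the copies. -/
instance : AddAction (ZMod r) (Copies r A) where
  vadd g p := (g + p.1, p.2)
  zero_vadd p := Prod.ext (zero_add p.1) rfl
  add_vadd g h p := Prod.ext (add_assoc g h p.1) rfl

/-- A finite set of vertices is an `r`-tuple of subsets of `A`; this is its `i`-th entry. -/
def part (σ : Finset (Copies r A)) (i : ZMod r) : Set A :=
  {a | ((i, a) : ZMod r × A) ∈ σ}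

theorem part_mono {σ τ : Finset (Copies r A)} (h : τ ⊆ σ) (i : ZMod r) :
    part τ i ⊆ part σ i := fun _ ha => h ha

theorem part_map (g : ZMod r) (σ : Finset (Copies r A)) (i : ZMod r) :
    part (σ.map (AddAction.toPerm g).toEmbedding) i = part σ (-g + i) := by
  ext a
  constructor
  · intro h
    obtain ⟨⟨j, b⟩, hp, h⟩ := Finset.mem_map.1 h
    have h1 : g + j = i := congrArg Prod.fst h
    have h2 : b = a := congrArg Prod.snd h
    subst h1 h2
    change ((-g + (g + j), b) : ZMod r × A) ∈ σ
    rwa [neg_add_cancel_left]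
  · intro h
    exact Finset.mem_map.2 ⟨_, h, Prod.ext (add_neg_cancel_left g i) rfl⟩

end Copies

open Copies

variable {r : ℕ} [NeZero r] {V : Type*}

/-- The box complex: the simplices are the `r`-tuples `(U_i)` of sets of nodes, not all empty, such
that if all `U_i` are nonempty then each choice of `u_i ∈ U_i` gives a hyperedge `{{u_i}}`. -/
def boxComplex (S : UniformHypergraph r V) : PreAbstractSimplicialComplex (Copies r V) where
  faces := {σ | σ.Nonempty ∧ ((∀ i, (part σ i).Nonempty) →
    ∀ u : ZMod r → V, (∀ i, u i ∈ part σ i) → Finset.univ.val.map u ∈ S.edges)}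
  isRelLowerSet_faces := by
    rintro σ ⟨hσ, h⟩
    refine ⟨hσ, fun τ hτ hne => ⟨hne, fun h' u hu => ?_⟩⟩
    exact h (fun i => (h' i).mono (part_mono hτ i)) u fun i => part_mono hτ i (hu i)

/-- For a hypergraph given by `r`-element sets, the box complex is described by sets
`{u_1, …, u_r}` instead of multisets. -/
theorem mem_boxComplex_ofSets [DecidableEq V] (hr : 2 ≤ r) (E : Set (Finset V))
    (hE : ∀ e ∈ E, e.card = r) (σ : Finset (Copies r V)) :
    σ ∈ (boxComplex (UniformHypergraph.ofSets hr E hE)).faces ↔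
      σ.Nonempty ∧ ((∀ i, (part σ i).Nonempty) →
        ∀ u : ZMod r → V, (∀ i, u i ∈ part σ i) → Finset.univ.image u ∈ E) := by
  have key : ∀ u : ZMod r → V, Finset.univ.val.map u ∈ Finset.val '' E ↔
      Finset.univ.image u ∈ E := by
    intro u
    constructor
    · rintro ⟨e, he, h⟩
      have : Finset.univ.image u = e := by
        apply Finset.val_injective
        rw [Finset.image_val, ← h, Multiset.dedup_eq_self.2 e.nodup]
      rwa [this]
    · intro h
      refine ⟨_, h, ?_⟩
      have hc : (Finset.univ.image u).card = (Finset.univ : Finset (ZMod r)).card := by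
        rw [hE _ h, Finset.card_univ, ZMod.card]
      exact Finset.image_val_of_injOn (Finset.card_image_iff.1 hc)
  constructor
  · rintro ⟨h1, h2⟩
    exact ⟨h1, fun h u hu => (key u).1 (h2 h u hu)⟩
  · rintro ⟨h1, h2⟩
    exact ⟨h1, fun h u hu => (key u).2 (h2 h u hu)⟩

instance (S : UniformHypergraph r V) : IsInvariant (ZMod r) (boxComplex S) where
  map_mem := by
    rintro g σ ⟨hσ, h⟩
    refine ⟨hσ.map, fun h' u hu => ?_⟩
    simp only [part_map] at h' hu
    have h1 := h (fun i => by simpa using h' (g + i)) (fun i => u (g + i))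
      fun i => by simpa using hu (g + i)
    have h2 : (Finset.univ : Finset (ZMod r)).val.map (fun i => g + i) = Finset.univ.val := by
      exact congrArg Finset.val (Finset.map_univ_equiv (Equiv.addLeft g))
    rw [← h2, Multiset.map_map]
    exact h1

/-- The colour complex on `m` colours, i.e. the `r`-fold `r`-wise deleted join of the simplex with
vertex set `Fin m`: the simplices are the `r`-tuples `(C_i)` of subsets of `Fin m`, not all empty,
with empty intersection. -/
def colourComplex (r m : ℕ) : PreAbstractSimplicialComplex (Copies r (Fin m)) where
  faces := {σ | σ.Nonempty ∧ ⋂ i, part σ i = ∅}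
  isRelLowerSet_faces := by
    rintro σ ⟨hσ, h⟩
    refine ⟨hσ, fun τ hτ hne => ⟨hne, ?_⟩⟩
    exact Set.subset_empty_iff.1 (h ▸ Set.iInter_mono fun i => part_mono hτ i)

/-- The map on vertices induced by `c`, which sends the node `v` in coordinate `i` to the colour
`c v` in coordinate `i`. -/
def inducedMap (r : ℕ) {m : ℕ} (c : V → Fin m) (p : Copies r V) : Copies r (Fin m) :=
  (p.1, c p.2)

end BoxIndex

open BoxIndex

/-!
For a colouring `c` of the hypergraph with `m` colours, the map `f_c` is simplicial: if a simplex of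
the box complex had the colour `b` in each copy of its image, then choosing in each copy a node of
colour `b` would give a monochromatic hyperedge. So the realization of the box complex maps
equivariantly to that of the colour complex, and the bound on the index follows once the latter is
known to be an `E_n`-space for `n = (r - 1) m - 1`.

The dimension is `n` because a simplex of the colour complex misses each colour in at least one copy
(`card_le_of_mem_colourComplex`, `dim_colourComplex`). Freeness of both complexes comes from
primality: a point fixed by a nontrivial shift has equal coordinates in all copies, so its support
contains all shifts of some vertex, which no simplex does (`isFreeSpace_realization`).

The colour complex is an `m`-fold join of boundaries of `(r - 1)`-simplices, hence a sphere of
dimension `n`. The proof that it is `(n - 1)`-connected uses less: its points are the points `x` of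
the standard simplex with `min_i x (i, a) = 0` for each colour `a`
(`mem_realization_colourComplex`), so that, via `x ↦ x (i, a) - x (0, a)`, it is a retract of the
complement of the origin in `ℝ^((r-1)m)`. The retraction subtracts the minimum over the copies from
each coordinate and rescales (`toRealization_ofRealization`). A map from the sphere in `ℝ^j` to this
complement extends to the ball for `j < (r - 1) m`, since a generic translate of a smooth
approximation to any extension avoids the origin (`exists_nonvanishing_extension`).
-/

namespace BoxIndex

open Module

/-! ### Extending nowhere vanishing maps -/

/-- General position: over a domain of smaller dimension than the target, a nowhere vanishing map
on a compact set extends to a nowhere vanishing map on the whole space. -/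
theorem exists_nonvanishing_extension {E F : Type}
    [NormedAddCommGroup E] [NormedSpace ℝ E] [FiniteDimensional ℝ E]
    [NormedAddCommGroup F] [NormedSpace ℝ F] [FiniteDimensional ℝ F]
    (hEF : finrank ℝ E < finrank ℝ F) {s : Set E} (hs : IsCompact s)
    (f : C(s, F)) (hf : ∀ x, f x ≠ 0) :
    ∃ H : C(E, F), (∀ x, H x ≠ 0) ∧ ∀ x : s, H x = f x := by
  have : CompactSpace s := isCompact_iff_compactSpace.1 hs
  obtain ⟨δ, hδ, hfδ⟩ : ∃ δ : ℝ, 0 < δ ∧ ∀ x, 2 * δ ≤ ‖f x‖ := by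
    rcases isEmpty_or_nonempty s with h | h
    · exact ⟨1, one_pos, fun x => h.elim x⟩
    · obtain ⟨x, -, hx⟩ := isCompact_univ.exists_isMinOn Set.univ_nonempty
        (f.continuous.norm.continuousOn)
      exact ⟨‖f x‖ / 2, half_pos (norm_pos_iff.2 (hf x)), fun y => by
        linarith [isMinOn_iff.1 hx y (Set.mem_univ y)]⟩
  obtain ⟨F₀, hF₀⟩ := f.exists_restrict_eq hs.isClosed
  have hF₀f : ∀ x : s, F₀ x = f x := fun x => DFunLike.congr_fun hF₀ x
  obtain ⟨P, hP, hPF, -⟩ := F₀.continuous.exists_contDiff_approx 1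
    (ε := fun _ => δ / 2) continuous_const (fun _ => half_pos hδ)
  obtain ⟨w, hw, hwδ⟩ := (hP.dense_compl_range_of_finrank_lt_finrank hEF).exists_dist_lt 0
    (half_pos hδ)
  have hQF : ∀ x, ‖(P x - w) - F₀ x‖ < δ := fun x => by
    have h1 := hPF x
    rw [dist_eq_norm] at h1
    rw [dist_zero_left] at hwδ
    calc ‖(P x - w) - F₀ x‖ = ‖(P x - F₀ x) - w‖ := by congr 1; abel
      _ ≤ ‖P x - F₀ x‖ + ‖w‖ := norm_sub_le _ _
      _ < δ := by linarith
  -- `φ` is `1` where `‖F₀‖ ≥ 2δ`, in particular on `s`, and `0` where `‖F₀‖ ≤ δ`. So the map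
  -- below is `F₀` on `s`; it is the nowhere vanishing `P - w` where `‖F₀‖ ≤ δ`, and elsewhere it is
  -- closer than `δ` to `F₀`, hence nonzero.
  let φ : E → ℝ := fun x => max 0 (min 1 (‖F₀ x‖ / δ - 1))
  have hφ : Continuous φ := by fun_prop
  refine ⟨⟨fun x => (P x - w) + φ x • (F₀ x - (P x - w)), ?_⟩, fun x => ?_, fun x => ?_⟩
  · have := hP.continuous
    fun_prop
  · simp only [ContinuousMap.coe_mk]
    rcases le_or_gt ‖F₀ x‖ δ with h | h
    · have : φ x = 0 := max_eq_left ((min_le_right _ _).trans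
        (by rw [sub_nonpos, div_le_one hδ]; exact h))
      rw [this, zero_smul, add_zero, sub_ne_zero]
      exact fun h => hw ⟨x, h⟩
    · intro h0
      have h1 : F₀ x = (1 - φ x) • (F₀ x - (P x - w)) := by
        rw [sub_smul, one_smul]
        rw [add_comm, ← eq_neg_iff_add_eq_zero] at h0
        rw [h0]; abel
      have h2 : 0 ≤ φ x := le_max_left _ _
      have h3 : φ x ≤ 1 := max_le zero_le_one (min_le_left _ _)
      have h4 := congrArg norm h1
      rw [norm_smul, Real.norm_of_nonneg (by linarith), norm_sub_rev] at h4
      have h5 := hQF x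
      have h6 : (1 - φ x) * ‖P x - w - F₀ x‖ ≤ 1 * ‖P x - w - F₀ x‖ :=
        mul_le_mul_of_nonneg_right (by linarith) (norm_nonneg _)
      linarith
  · have h1 : φ x = 1 := by
      have : 2 ≤ ‖F₀ x‖ / δ := by rw [le_div_iff₀ hδ, hF₀f]; exact hfδ x
      simp only [φ]
      rw [min_eq_left (by linarith), max_eq_right zero_le_one]
    simp only [ContinuousMap.coe_mk, h1, one_smul, ← hF₀f]
    abel

/-! ### Simplicial maps and free actions on realizations -/

section Realization

variable {ι κ : Type*} [Fintype ι] [Fintype κ]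

/-- The map of realizations given by a simplicial map `f`: it is affine on each simplex. -/
noncomputable def realizationMap [DecidableEq κ] {K : PreAbstractSimplicialComplex ι}
    {L : PreAbstractSimplicialComplex κ} {f : ι → κ} (hf : IsSimplicialMap K L f) :
    C(realization K, realization L) where
  toFun x := ⟨fun q => ∑ p with f p = q, x.1 p, by
    obtain ⟨x, ⟨h0, h1⟩, σ, hσ, hx⟩ := x
    refine ⟨⟨fun q => Finset.sum_nonneg fun p _ => h0 p, ?_⟩, _, hf σ hσ, fun q hq => ?_⟩
    · exact (Finset.sum_fiberwise _ _ _).trans h1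
    · refine Finset.sum_eq_zero fun p hp => hx p fun h => hq ?_
      exact Finset.mem_image.2 ⟨p, h, (Finset.mem_filter.1 hp).2⟩⟩
  continuous_toFun := by
    refine Continuous.subtype_mk (continuous_pi fun q => continuous_finsetSum _ fun p _ => ?_) _
    exact (continuous_apply p).comp continuous_subtype_val

theorem realizationMap_vadd {G : Type*} [AddGroup G] [AddAction G ι] [AddAction G κ]
    [DecidableEq κ] {K : PreAbstractSimplicialComplex ι} {L : PreAbstractSimplicialComplex κ}
    [IsInvariant G K] [IsInvariant G L] {f : ι → κ} (hf : IsSimplicialMap K L f)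
    (hfG : ∀ (g : G) (p : ι), f (g +ᵥ p) = g +ᵥ f p) (g : G) (x : realization K) :
    realizationMap hf (g +ᵥ x) = g +ᵥ realizationMap hf x := by
  apply Subtype.ext
  funext q
  change ∑ p with f p = q, x.1 (-g +ᵥ p) = ∑ p with f p = -g +ᵥ q, x.1 p
  refine Finset.sum_equiv (AddAction.toPerm (-g)) (fun p => ?_) fun p _ => rfl
  simp [hfG]

theorem continuous_realization_vadd {G : Type*} [AddGroup G] [AddAction G ι]
    (K : PreAbstractSimplicialComplex ι) [IsInvariant G K] (g : G) :
    Continuous fun x : realization K => g +ᵥ x := by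
  have h : Continuous fun (x : realization K) (p : ι) => x.1 (-g +ᵥ p) :=
    continuous_pi fun p => (continuous_apply (-g +ᵥ p)).comp continuous_subtype_val
  exact h.subtype_mk _

end Realization

open Copies

variable {r : ℕ}

/-- Because `r` is prime, a point fixed by a nontrivial shift has the same coordinates in all copies;
so there is none if no simplex contains all shifts of some vertex. -/
theorem isFreeSpace_realization [Fact r.Prime] {A : Type*} [Fintype A]
    (K : PreAbstractSimplicialComplex (Copies r A)) [IsInvariant (ZMod r) K]
    (hK : ∀ σ ∈ K.faces, ∀ a, ∃ i, a ∉ part σ i) :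
    IsFreeSpace r (realization K) := by
  refine ⟨continuous_realization_vadd K, fun g hg x hx => ?_⟩
  obtain ⟨x, ⟨h0, h1⟩, σ, hσ, hxσ⟩ := x
  have hgx : ∀ i a, x (g + i, a) = x (i, a) := fun i a => by
    have h := congrFun (congrArg Subtype.val hx) ((g + i, a) : ZMod r × A)
    change x (-g + (g + i), a) = x (g + i, a) at h
    rw [neg_add_cancel_left] at h
    exact h.symm
  have hng : ∀ (n : ℕ) i a, x (n • g + i, a) = x (i, a) := fun n i a => by
    induction n with
    | zero => simp
    | succ n ih => rw [succ_nsmul', add_assoc, hgx, ih]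
  have hall : ∀ i j a, x (i, a) = x (j, a) := fun i j a => by
    -- `r` is prime, so `i - j` is a multiple of `g`
    have h := hng ((i - j) / g).val j a
    rwa [nsmul_eq_mul, ZMod.natCast_val, ZMod.cast_id', id, div_mul_cancel₀ _ hg,
      sub_add_cancel] at h
  have hzero : ∀ p, x p = 0 := fun ⟨j, a⟩ => by
    obtain ⟨i, hi⟩ := hK σ hσ a
    exact (hall j i a).trans (hxσ (i, a) hi)
  simp [hzero] at h1

/-! ### The box complex -/

theorem exists_notMem_part_boxComplex [NeZero r] {V : Type*} (S : UniformHypergraph r V)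
    (σ : Finset (Copies r V)) (hσ : σ ∈ (boxComplex S).faces) (v : V) :
    ∃ i, v ∉ part σ i := by
  by_contra! h
  obtain ⟨x, hx, y, hy, hxy⟩ := S.exists_ne _ (hσ.2 (fun i => ⟨v, h i⟩) (fun _ => v) h)
  obtain ⟨-, -, rfl⟩ := Multiset.mem_map.1 hx
  obtain ⟨-, -, rfl⟩ := Multiset.mem_map.1 hy
  exact hxy rfl

theorem isSimplicialMap_inducedMap [NeZero r] {V : Type*} (S : UniformHypergraph r V) {m : ℕ}
    {c : V → Fin m} (hc : S.IsColouring c) :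
    IsSimplicialMap (boxComplex S) (colourComplex r m) (inducedMap r c) := by
  rintro σ ⟨hσ, h⟩
  refine ⟨hσ.image _, Set.eq_empty_iff_forall_notMem.2 fun b hb => ?_⟩
  have hb' : ∀ i, ∃ v ∈ part σ i, c v = b := fun i => by
    obtain ⟨⟨j, v⟩, hp, hq⟩ := Finset.mem_image.1 (Set.mem_iInter.1 hb i)
    obtain rfl : j = i := congrArg Prod.fst hq
    exact ⟨v, hp, congrArg Prod.snd hq⟩
  choose u hu hcu using hb'
  obtain ⟨x, hx, y, hy, hxy⟩ := hc _ (h (fun i => ⟨u i, hu i⟩) u hu)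
  obtain ⟨i, -, rfl⟩ := Multiset.mem_map.1 hx
  obtain ⟨j, -, rfl⟩ := Multiset.mem_map.1 hy
  exact hxy ((hcu i).trans (hcu j).symm)

theorem inducedMap_vadd {V : Type*} {m : ℕ} (c : V → Fin m) (g : ZMod r) (p : Copies r V) :
    inducedMap r c (g +ᵥ p) = g +ᵥ inducedMap r c p :=
  rfl

theorem UniformHypergraph.colourable_card {V : Type*} [Fintype V] (S : UniformHypergraph r V) :
    S.Colourable (Fintype.card V) := by
  refine ⟨Fintype.equivFin V, fun e he => ?_⟩
  obtain ⟨x, hx, y, hy, hxy⟩ := S.exists_ne e he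
  exact ⟨x, hx, y, hy, (Fintype.equivFin V).injective.ne hxy⟩

/-! ### The colour complex -/

section ColourComplex

variable {m : ℕ}

instance : IsInvariant (ZMod r) (colourComplex r m) where
  map_mem := by
    rintro g σ ⟨hσ, h⟩
    refine ⟨hσ.map, ?_⟩
    simp only [part_map]
    exact ((Equiv.addLeft (-g)).iInf_comp (g := part σ)).trans h

theorem exists_notMem_part_colourComplex (σ : Finset (Copies r (Fin m)))
    (hσ : σ ∈ (colourComplex r m).faces) (a : Fin m) : ∃ i, a ∉ part σ i := by
  have h : a ∉ ⋂ i, part σ i := hσ.2 ▸ Set.notMem_empty a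
  simpa using h

theorem mem_realization_colourComplex [NeZero r] {x : Copies r (Fin m) → ℝ} :
    x ∈ realization (colourComplex r m) ↔
      x ∈ stdSimplex ℝ (Copies r (Fin m)) ∧ ∀ a, ∃ i : ZMod r, x (i, a) = 0 := by
  constructor
  · rintro ⟨hx, σ, hσ, hxσ⟩
    refine ⟨hx, fun a => ?_⟩
    obtain ⟨i, hi⟩ := exists_notMem_part_colourComplex σ hσ a
    exact ⟨i, hxσ _ hi⟩
  · rintro ⟨hx, h⟩
    have hp : ∀ p, p ∈ Finset.univ.filter (fun p => x p ≠ 0) ↔ x p ≠ 0 := by simp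
    refine ⟨hx, Finset.univ.filter (fun p => x p ≠ 0), ⟨?_, ?_⟩, fun p h => ?_⟩
    · by_contra! h0
      have : ∀ p, x p = 0 := by simpa [h0] using hp
      simpa [this] using hx.2
    · refine Set.eq_empty_iff_forall_notMem.2 fun a ha => ?_
      obtain ⟨i, hi⟩ := h a
      exact (hp _).1 (Set.mem_iInter.1 ha i) hi
    · simpa using h

theorem card_copies [NeZero r] : Fintype.card (Copies r (Fin m)) = r * m := by
  change Fintype.card (ZMod r × Fin m) = _
  simp [ZMod.card]

theorem card_le_of_mem_colourComplex [NeZero r] (σ : Finset (Copies r (Fin m)))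
    (hσ : σ ∈ (colourComplex r m).faces) : σ.card ≤ (r - 1) * m := by
  choose i hi using exists_notMem_part_colourComplex σ hσ
  let j : Fin m ↪ Copies r (Fin m) := ⟨fun a => (i a, a), fun a b h => congrArg Prod.snd h⟩
  have hd : Disjoint σ (Finset.univ.map j) := by
    rw [Finset.disjoint_right]
    intro p hp
    obtain ⟨a, -, rfl⟩ := Finset.mem_map.1 hp
    exact hi a
  have h := Finset.card_le_univ (σ.disjUnion _ hd)
  rw [Finset.card_disjUnion, card_copies, Finset.card_map, Finset.card_univ, Fintype.card_fin] at h
  rw [Nat.sub_one_mul]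
  omega

theorem dim_le_of_card_le {ι : Type*} [Fintype ι] (K : PreAbstractSimplicialComplex ι) (d : ℕ)
    (h : ∀ σ ∈ K.faces, σ.card ≤ d) : dim K ≤ d - 1 := by
  classical
  unfold dim
  have : (Finset.univ.filter (· ∈ K.faces)).sup Finset.card ≤ d :=
    Finset.sup_le fun σ hσ => h σ (Finset.mem_filter.1 hσ).2
  gcongr

theorem dim_colourComplex [Fact r.Prime] :
    dim (colourComplex r m) = ((r - 1) * m : ℕ) - 1 := by
  classical
  refine le_antisymm (dim_le_of_card_le _ _ card_le_of_mem_colourComplex) ?_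
  unfold dim
  gcongr
  -- all vertices outside the copy with index `0`
  let j : {i : ZMod r // i ≠ 0} × Fin m ↪ Copies r (Fin m) :=
    ⟨fun q => (q.1.1, q.2), fun p q h =>
      Prod.ext (Subtype.ext (Prod.ext_iff.1 h).1) (Prod.ext_iff.1 h).2⟩
  have hj : (Finset.univ.map j).card = (r - 1) * m := by
    simp [ZMod.card, Fintype.card_subtype_compl]
  rcases Nat.eq_zero_or_pos ((r - 1) * m) with h | h
  · simp [h]
  rw [← hj]
  refine Finset.le_sup (f := Finset.card) (Finset.mem_filter.2 ⟨Finset.mem_univ _, ?_, ?_⟩)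
  · exact Finset.card_pos.1 (hj ▸ h)
  · refine Set.eq_empty_iff_forall_notMem.2 fun a ha => ?_
    obtain ⟨q, -, hq⟩ := Finset.mem_map.1 (Set.mem_iInter.1 ha 0)
    exact q.1.2 (congrArg Prod.fst hq)

/-- Subtract from each coordinate the smallest coordinate of the same colour. -/
noncomputable def subMin [NeZero r] (z : Copies r (Fin m) → ℝ) (p : Copies r (Fin m)) : ℝ :=
  z p - Finset.univ.inf' Finset.univ_nonempty fun j : ZMod r => z (j, p.2)

theorem subMin_nonneg [NeZero r] (z : Copies r (Fin m) → ℝ) (p : Copies r (Fin m)) :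
    0 ≤ subMin z p :=
  sub_nonneg.2 (Finset.inf'_le (fun j : ZMod r => z (j, p.2)) (Finset.mem_univ p.1))

theorem exists_subMin_eq_zero [NeZero r] (z : Copies r (Fin m) → ℝ) (a : Fin m) :
    ∃ i : ZMod r, subMin z (i, a) = 0 := by
  obtain ⟨i, -, hi⟩ := Finset.exists_mem_eq_inf' Finset.univ_nonempty fun j : ZMod r => z (j, a)
  exact ⟨i, sub_eq_zero.2 hi.symm⟩

theorem subMin_eq_of_sub_eq [NeZero r] {x z : Copies r (Fin m) → ℝ} (hx : ∀ p, 0 ≤ x p)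
    (hx0 : ∀ a, ∃ i : ZMod r, x (i, a) = 0) (t : Fin m → ℝ)
    (hz : ∀ p, z p = x p - t p.2) : subMin z = x := by
  funext p
  obtain ⟨i, hi⟩ := hx0 p.2
  have h : (Finset.univ.inf' Finset.univ_nonempty fun j : ZMod r => z (j, p.2)) = -t p.2 := by
    apply le_antisymm
    · refine (Finset.inf'_le _ (Finset.mem_univ i)).trans ?_
      exact ((hz (i, p.2)).trans (by rw [hi, zero_sub])).le
    · refine Finset.le_inf' _ _ fun j _ => ?_
      have h1 : z (j, p.2) = x (j, p.2) - t p.2 := hz (j, p.2)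
      linarith [hx (j, p.2)]
  rw [subMin, h, hz, sub_neg_eq_add, sub_add_cancel]

theorem continuous_coordinate (p : Copies r (Fin m)) :
    Continuous fun z : Copies r (Fin m) → ℝ => z p :=
  continuous_apply p

theorem continuous_subMin [NeZero r] : Continuous (subMin (r := r) (m := m)) :=
  continuous_pi fun p => (continuous_coordinate p).sub
    (Continuous.finset_inf'_apply _ fun j _ => continuous_coordinate (j, p.2))

/-- Coordinates modulo constants on each colour: `ℝ^((r-1)m)`, with the copy of index `0` as the
reference. -/
abbrev ReducedCoord (r m : ℕ) : Type :=
  {i : ZMod r // i ≠ 0} × Fin m → ℝ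

/-- The representative of a reduced vector that vanishes on the copy of index `0`. -/
def ReducedCoord.lift (y : ReducedCoord r m) (p : Copies r (Fin m)) : ℝ :=
  if h : p.1 ≠ 0 then y (⟨p.1, h⟩, p.2) else 0

theorem ReducedCoord.continuous_lift : Continuous (ReducedCoord.lift (r := r) (m := m)) := by
  refine continuous_pi fun p => ?_
  by_cases h : p.1 ≠ 0
  · have h' : (fun y : ReducedCoord r m => y.lift p) = fun y => y (⟨p.1, h⟩, p.2) :=
      funext fun y => dif_pos h
    exact h' ▸ continuous_apply _
  · have h' : (fun y : ReducedCoord r m => y.lift p) = fun _ => 0 := funext fun y => dif_neg h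
    exact h' ▸ continuous_const

theorem ReducedCoord.sum_subMin_lift_pos [NeZero r] {y : ReducedCoord r m} (hy : y ≠ 0) :
    0 < ∑ p, subMin y.lift p := by
  refine (Finset.sum_nonneg fun p _ => subMin_nonneg _ p).lt_of_ne' fun h => hy ?_
  have h0 := (Finset.sum_eq_zero_iff_of_nonneg fun p _ => subMin_nonneg y.lift p).1 h
  funext ⟨⟨i, hi⟩, a⟩
  have h1 := h0 ((i, a) : ZMod r × Fin m) (Finset.mem_univ _)
  have h2 := h0 ((0, a) : ZMod r × Fin m) (Finset.mem_univ _)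
  have h3 : y.lift (i, a) = y.lift (0, a) := by
    unfold subMin at h1 h2
    simp only at h1 h2
    linarith
  simpa [lift, hi] using h3

/-- Every nonzero reduced vector has a unique representative with smallest coordinate `0` in each
colour; scaled to sum `1`, it is a point of the realization of the colour complex. -/
noncomputable def toRealization [NeZero r] :
    C({y : ReducedCoord r m // y ≠ 0}, realization (colourComplex r m)) where
  toFun y := ⟨fun p => subMin y.1.lift p / ∑ q, subMin y.1.lift q, by
    have hy := ReducedCoord.sum_subMin_lift_pos y.2
    refine mem_realization_colourComplex.2 ⟨⟨fun p => ?_, ?_⟩, fun a => ?_⟩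
    · exact div_nonneg (subMin_nonneg _ p) hy.le
    · rw [← Finset.sum_div, div_self hy.ne']
    · obtain ⟨i, hi⟩ := exists_subMin_eq_zero y.1.lift a
      exact ⟨i, by rw [hi, zero_div]⟩⟩
  continuous_toFun := by
    have h : Continuous fun y : {y : ReducedCoord r m // y ≠ 0} => subMin y.1.lift :=
      continuous_subMin.comp (ReducedCoord.continuous_lift.comp continuous_subtype_val)
    have h' := continuous_pi_iff.1 h
    exact Continuous.subtype_mk (continuous_pi fun p => (h' p).div
      (continuous_finsetSum _ fun q _ => h' q)
      fun y => (ReducedCoord.sum_subMin_lift_pos y.2).ne') _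

/-- The reduced coordinates of a point of the colour complex; they do not all vanish, because each
colour is missing in some copy. -/
def ofRealization [NeZero r] :
    C(realization (colourComplex r m), {y : ReducedCoord r m // y ≠ 0}) where
  toFun x := ⟨fun q => x.1 (q.1.1, q.2) - x.1 (0, q.2), fun h => by
    obtain ⟨x, hx⟩ := x
    obtain ⟨⟨-, h1⟩, h0⟩ := mem_realization_colourComplex.1 hx
    have hx0 : ∀ (i : ZMod r) a, x (i, a) = x (0, a) := fun i a => by
      by_cases hi : i = 0
      · rw [hi]
      · exact sub_eq_zero.1 (congrFun h (⟨i, hi⟩, a))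
    have hzero : ∀ p, x p = 0 := fun ⟨i, a⟩ => by
      obtain ⟨j, hj⟩ := h0 a
      exact (hx0 i a).trans ((hx0 j a).symm.trans hj)
    simp [hzero] at h1⟩
  continuous_toFun := by
    refine Continuous.subtype_mk (continuous_pi fun q => ?_) _
    exact ((continuous_coordinate (q.1.1, q.2)).comp continuous_subtype_val).sub
      ((continuous_coordinate (0, q.2)).comp continuous_subtype_val)

theorem toRealization_ofRealization [NeZero r] (x : realization (colourComplex r m)) :
    toRealization (ofRealization x) = x := by
  obtain ⟨x, hx⟩ := x
  obtain ⟨⟨hnn, h1⟩, h0⟩ := mem_realization_colourComplex.1 hx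
  have h : subMin (ofRealization ⟨x, hx⟩).1.lift = x := by
    refine subMin_eq_of_sub_eq hnn h0 (fun a => x (0, a)) fun ⟨i, a⟩ => ?_
    by_cases hi : i = 0
    · simp [ReducedCoord.lift, hi]
    · simp [ReducedCoord.lift, hi, ofRealization]
  apply Subtype.ext
  funext p
  change subMin (ofRealization ⟨x, hx⟩).1.lift p
    / ∑ q, subMin (ofRealization ⟨x, hx⟩).1.lift q = x p
  rw [h, h1, div_one]

theorem finrank_reducedCoord [Fact r.Prime] : finrank ℝ (ReducedCoord r m) = (r - 1) * m := by
  simp [ZMod.card, Fintype.card_subtype_compl]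

/-- The colour complex is a retract of the complement of the origin in `ℝ^((r-1)m)`. -/
theorem isKConnected_colourComplex [Fact r.Prime] :
    IsKConnected (((r - 1) * m : ℕ) - 2) (realization (colourComplex r m)) := by
  intro j hj f
  have hrank : finrank ℝ (EuclideanSpace ℝ (Fin j)) < finrank ℝ (ReducedCoord r m) := by
    rw [finrank_euclideanSpace_fin, finrank_reducedCoord]
    omega
  obtain ⟨H, hH, hHf⟩ := exists_nonvanishing_extension hrank (isCompact_sphere 0 1)
    ((⟨Subtype.val, continuous_subtype_val⟩ : C(_, _)).comp (ofRealization.comp f))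
    fun x => (ofRealization (f x)).2
  refine ⟨toRealization.comp ⟨fun x => ⟨H x, hH x⟩, by fun_prop⟩, fun x => ?_⟩
  rw [← toRealization_ofRealization (f x)]
  exact congrArg toRealization (Subtype.ext (hHf x))

theorem isESpace_colourComplex [Fact r.Prime] :
    IsESpace r (((r - 1) * m : ℕ) - 1) (realization (colourComplex r m)) where
  isFreeSpace := isFreeSpace_realization _ exists_notMem_part_colourComplex
  triangulated := ⟨Copies r (Fin m), inferInstance, colourComplex r m, dim_colourComplex,
    ⟨Homeomorph.refl _⟩⟩
  connected := by
    rw [show (((r - 1) * m : ℕ) : ℤ) - 1 - 1 = ((r - 1) * m : ℕ) - 2 by ring]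
    exact isKConnected_colourComplex

end ColourComplex

/-! ### The index -/

theorem bddBelow_indexSet (r : ℕ) (X : Type*) [TopologicalSpace X] [AddAction (ZMod r) X] :
    BddBelow (indexSet r X) := by
  refine ⟨-1, ?_⟩
  rintro n ⟨Y, _, _, hY, -⟩
  obtain ⟨ι, _, K, rfl, -⟩ := hY.triangulated
  classical
  change (-1 : ℤ) ≤ ((Finset.univ.filter (· ∈ K.faces)).sup Finset.card : ℕ) - 1
  omega

theorem mem_indexSet_boxComplex [Fact r.Prime] {V : Type*} [Fintype V] (S : UniformHypergraph r V)
    {m : ℕ} (hm : S.Colourable m) :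
    (((r - 1) * m : ℕ) - 1 : ℤ) ∈ indexSet r (realization (boxComplex S)) := by
  obtain ⟨c, hc⟩ := hm
  exact ⟨_, _, _, isESpace_colourComplex, realizationMap (isSimplicialMap_inducedMap S hc),
    realizationMap_vadd _ (inducedMap_vadd c)⟩

end BoxIndex

open BoxIndex
theorem mainTheorem3 {V : Type*} [Fintype V] (r : ℕ) [Fact r.Prime]
    (S : UniformHypergraph r V) :
    IsLeast {m : ℕ | S.Colourable m} S.chromaticNumber ∧
    IsFreeSpace r (realization (boxComplex S)) ∧
    IsLeast (indexSet r (realization (boxComplex S))) (zIndex r (realization (boxComplex S))) ∧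
    ⌈((zIndex r (realization (boxComplex S)) : ℚ) + 1) / ((r : ℚ) - 1)⌉
      ≤ (S.chromaticNumber : ℤ) ∧
    ∀ c : V → Fin S.chromaticNumber, S.IsColouring c →
      IsSimplicialMap (boxComplex S) (colourComplex r S.chromaticNumber) (inducedMap r c) ∧
      (∀ (g : ZMod r) (p : Copies r V), inducedMap r c (g +ᵥ p) = g +ᵥ inducedMap r c p) ∧
      dim ((boxComplex S).map (inducedMap r c)) ≤ ((r : ℤ) - 1) * S.chromaticNumber - 1 := by
  have hχ : S.Colourable S.chromaticNumber :=
    Nat.sInf_mem (s := {m | S.Colourable m}) ⟨_, S.colourable_card⟩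
  have hmem := mem_indexSet_boxComplex S hχ
  have hbdd := bddBelow_indexSet r (realization (boxComplex S))
  have hr : 2 ≤ r := (Fact.out : r.Prime).two_le
  have hcast : (((r - 1) * S.chromaticNumber : ℕ) : ℤ) = ((r : ℤ) - 1) * S.chromaticNumber := by
    push_cast [Nat.cast_sub (show 1 ≤ r by omega)]
    ring
  refine ⟨⟨hχ, fun m hm => Nat.sInf_le hm⟩,
    isFreeSpace_realization _ (exists_notMem_part_boxComplex S),
    ⟨Int.csInf_mem ⟨_, hmem⟩ hbdd, fun n hn => csInf_le hbdd hn⟩, ?_, fun c hc => ?_⟩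
  · have hle : zIndex r (realization (boxComplex S)) ≤ _ := csInf_le hbdd hmem
    rw [hcast] at hle
    have hr' : (0 : ℚ) < (r : ℚ) - 1 := by
      have : (2 : ℚ) ≤ r := by exact_mod_cast hr
      linarith
    rw [Int.ceil_le, div_le_iff₀ hr']
    have hle' : (zIndex r (realization (boxComplex S)) : ℚ) ≤
        ((r : ℚ) - 1) * S.chromaticNumber - 1 := by exact_mod_cast hle
    push_cast
    linarith
  · have hf := isSimplicialMap_inducedMap S hc
    refine ⟨hf, inducedMap_vadd c, ?_⟩
    rw [← hcast]
    refine dim_le_of_card_le _ _ ?_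
    rintro _ ⟨σ, hσ, rfl⟩
    exact card_le_of_mem_colourComplex _ (hf σ hσ)
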